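/- Let $M$ be a von Neumann algebra acting on a Hilbert space, with a faithful normal tracial state $\tau$ (so $M$ is finite), and let $A,B\subseteq M$ be (unital) von Neumann subalgebras. Let $E_A, E_B$ denote the unique $\tau$-preserving conditional expectations of $M$ onto $A$ and $B$. Let $\eta(t)=-t\log t$ for $t>0$ and $\eta(0)=0$, and let $\mathcal S$ be the set of all finite families $(x_i)_i$ of positive elements of $M$ with $\sum_i x_i=1$. The Connes–Størmer relative entropy and its modification (the conditional relative entropy) are $$H(A\mid B)=\sup_{(x_i)\in\mathcal S}\sum_i\bigl(\tau\eta E_B(x_i)-\tau\eta E_A(x_i)\bigr),\qquad h(A\mid B)=\sup_{(x_i)\in\mathcal S}\sum_i\bigl(\tau\eta E_B(E_A(x_i))-\tau\eta E_A(x_i)\bigr).$$ For positive linear functionals $\psi,\phi$ on a unital $C^*$-algebra $C$, let $S(\psi,\phi)$ be their relative entropy, given by Kosaki's expression $$S(\psi,\phi)=\sup_{n\in\mathbb N,\, n\ge 1}\ \sup_{x}\Bigl\{\psi(1)\log n-\int_{1/n}^\infty\Bigl(\psi(y(t)^*y(t))+\tfrac1t\,\phi(x(t)x(t)^*)\Bigr)\frac{dt}{t}\Bigr\},$$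 where $x:(1/n,\infty)\to C$ runs over the measurable step functions with finite range and $y(t)=1-x(t)$. For a normal state $\phi$ on $M$, let $\Phi$ be the set of all finite families $(\phi_i)_i$ of positive linear functionals on $M$ with $\sum_i\phi_i=\phi$, and put $$H_\phi(A\mid B)=\sup_{(\phi_i)\in\Phi}\sum_i\bigl(S(\phi_i|_A,\phi|_A)-S(\phi_i|_B,\phi|_B)\bigr),$$ $$h_\phi(A\mid B)=\sup_{(\phi_i)\in\Phi}\sum_i\bigl(S(\phi_i|_A,\phi|_A)-S((\phi_i\circ E_A)|_B,(\phi\circ E_A)|_B)\bigr).$$ All suprema are taken in $[-\infty,+\infty]$. Assume that $E_AE_B=E_BE_A$ (the commuting square condition). Then $$H(A\mid B)=h(A\mid B).$$ Moreover, if $\phi$ is a normal state on $M$ with $\phi=\phi\circ E_A$, then $$H_\phi(A\mid B)=h_\phi(A\mid B).$$ -/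

import Mathlib

open scoped MeasureTheory ComplexOrder ENNReal InnerProductSpace

namespace VNEntropy

section KosakiEntropy

variable {C : Type*} [Ring C] [StarRing C] [Algebra ℂ C]

/-- The relative entropy `S(ψ, φ)` of two positive linear functionals on a unital C*-algebra `C`,
given by Kosaki's variational expression
`sup_n sup_x { ψ(1) log n - ∫_{1/n}^∞ (ψ(y(t)* y(t)) + t⁻¹ φ(x(t) x(t)*)) dt / t }`,
where `n` runs over the positive integers, `x` over the measurable `C`-valued step functions with
finite range, and `y(t) = 1 - x(t)`.  The integrand is nonnegative and the integral is a Lebesgue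
integral with values in `[0, ∞]`.  In the matrix case this is `Tr(ρ_ψ (log ρ_ψ - log ρ_φ))`. -/
noncomputable def relEntropy (ψ φ : C →ₗ[ℂ] ℂ) : EReal :=
  ⨆ (n : ℕ) (_ : 1 ≤ n) (x : MeasureTheory.SimpleFunc ℝ C),
    (((ψ 1).re * Real.log n : ℝ) : EReal) -
      ((∫⁻ t in Set.Ioi (1 / (n : ℝ)),
        ENNReal.ofReal
          (((ψ (star (1 - x t) * (1 - x t))).re + t⁻¹ * (φ (x t * star (x t))).re) / t) : ℝ≥0∞) :
        EReal)

end KosakiEntropy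

variable {H : Type*} [NormedAddCommGroup H] [InnerProductSpace ℂ H] [CompleteSpace H]

/-- The elements of a von Neumann algebra, as a *-algebra over `ℂ`. -/
abbrev Elem (M : VonNeumannAlgebra H) : Type _ := M.toStarSubalgebra

section Functionals

variable {M : VonNeumannAlgebra H}

/-- A positive linear functional on `M`. -/
def IsPositiveFunctional (φ : Elem M →ₗ[ℂ] ℂ) : Prop :=
  ∀ x : Elem M, (x : H →L[ℂ] H).IsPositive → 0 ≤ φ x

/-- A state on `M`. -/
structure IsState (φ : Elem M →ₗ[ℂ] ℂ) : Prop where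
  positive : IsPositiveFunctional φ
  map_one : φ 1 = 1

/-- A normal, i.e. ultraweakly continuous, linear functional on `M`: one of the form
`x ↦ ∑ₙ ⟪ξₙ, x ηₙ⟫` with `∑ₙ ‖ξₙ‖² < ∞` and `∑ₙ ‖ηₙ‖² < ∞`. -/
def IsNormalFunctional (φ : Elem M →ₗ[ℂ] ℂ) : Prop :=
  ∃ ξ η : ℕ → H, (Summable fun n => ‖ξ n‖ ^ 2) ∧ (Summable fun n => ‖η n‖ ^ 2) ∧
    ∀ x : Elem M, HasSum (fun n => ⟪ξ n, (x : H →L[ℂ] H) (η n)⟫_ℂ) (φ x)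

/-- A faithful normal tracial state on `M`. -/
structure IsFaithfulNormalTracialState (τ : Elem M →ₗ[ℂ] ℂ) : Prop where
  state : IsState τ
  normal : IsNormalFunctional τ
  tracial : ∀ x y : Elem M, τ (x * y) = τ (y * x)
  faithful : ∀ x : Elem M, τ (star x * x) = 0 → x = 0

/-- The restriction of a functional on `M` to a von Neumann subalgebra `A`. -/
noncomputable def restrict {A : VonNeumannAlgebra H} (hA : A ≤ M) (φ : Elem M →ₗ[ℂ] ℂ) : Elem A →ₗ[ℂ] ℂ :=
  φ ∘ₗ (StarSubalgebra.inclusion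
    (show A.toStarSubalgebra ≤ M.toStarSubalgebra from fun _ hx => hA hx)).toAlgHom.toLinearMap

/-- `E : M → M` is a `τ`-preserving conditional expectation of `M` onto `A`: a positive linear
`A`-bimodule projection with range `A` and `τ ∘ E = τ`. -/
structure IsTraceCondExp (τ : Elem M →ₗ[ℂ] ℂ) (A : VonNeumannAlgebra H)
    (E : Elem M →ₗ[ℂ] Elem M) : Prop where
  mem : ∀ x : Elem M, (E x : H →L[ℂ] H) ∈ A
  map_of_mem : ∀ x : Elem M, (x : H →L[ℂ] H) ∈ A → E x = x
  positive : ∀ x : Elem M, (x : H →L[ℂ] H).IsPositive → (E x : H →L[ℂ] H).IsPositive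
  bimodule : ∀ a x b : Elem M, (a : H →L[ℂ] H) ∈ A → (b : H →L[ℂ] H) ∈ A →
    E (a * x * b) = a * E x * b
  trace : ∀ x : Elem M, τ (E x) = τ x

/-- There is at most one `τ`-preserving conditional expectation onto a subalgebra. -/
theorem IsTraceCondExp.unique {τ : Elem M →ₗ[ℂ] ℂ} (hτ : IsFaithfulNormalTracialState τ)
    {A : VonNeumannAlgebra H} {E F : Elem M →ₗ[ℂ] Elem M}
    (hE : IsTraceCondExp τ A E) (hF : IsTraceCondExp τ A F) : E = F := by
  have key : ∀ (G : Elem M →ₗ[ℂ] Elem M), IsTraceCondExp τ A G → ∀ a x : Elem M,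
      (a : H →L[ℂ] H) ∈ A → τ (a * G x) = τ (a * x) := by
    intro G hG a x ha
    have h := hG.bimodule a x 1 ha (one_mem A)
    rw [mul_one, mul_one] at h
    rw [← h, hG.trace]
  ext1 x
  rw [← sub_eq_zero]
  refine hτ.faithful _ ?_
  have hd : ((star (E x - F x) : Elem M) : H →L[ℂ] H) ∈ A :=
    star_mem (sub_mem (hE.mem x) (hF.mem x))
  rw [mul_sub, map_sub, key E hE _ x hd, key F hF _ x hd, sub_self]

open Classical in
/-- The `τ`-preserving conditional expectation `E_A` of `M` onto `A`. It exists and is unique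
when `τ` is a faithful normal tracial state and `A ≤ M`; otherwise the value is irrelevant. -/
noncomputable def condExp (τ : Elem M →ₗ[ℂ] ℂ) (A : VonNeumannAlgebra H) :
    Elem M →ₗ[ℂ] Elem M :=
  if h : ∃ E, IsTraceCondExp τ A E then h.choose else 0

end Functionals

/-- A von Neumann algebra is stable under the continuous functional calculus. -/
theorem cfc_mem (M : VonNeumannAlgebra H) (f : ℝ → ℝ) {x : H →L[ℂ] H} (hx : x ∈ M) :
    cfc f x ∈ M := by
  rw [← VonNeumannAlgebra.commutant_commutant M, VonNeumannAlgebra.mem_commutant_iff]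
  intro g hg
  rw [VonNeumannAlgebra.mem_commutant_iff] at hg
  have hc : Commute x g := hg x hx
  exact (hc.cfc_real f).eq.symm

section Entropies

variable {M : VonNeumannAlgebra H}

/-- `η(x)`, by functional calculus, where `η(t) = -t log t`, `η(0) = 0`. -/
noncomputable def eta (x : Elem M) : Elem M :=
  ⟨cfc Real.negMulLog (x : H →L[ℂ] H), cfc_mem M _ x.2⟩

/-- The finite families of positive elements of `M` with sum `1`. -/
def IsPartition {n : ℕ} (x : Fin n → Elem M) : Prop :=
  (∀ i, (x i : H →L[ℂ] H).IsPositive) ∧ ∑ i, x i = 1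

/-- The finite families of positive linear functionals on `M` with sum `φ`. -/
def IsDecomposition (φ : Elem M →ₗ[ℂ] ℂ) {n : ℕ} (ψ : Fin n → (Elem M →ₗ[ℂ] ℂ)) : Prop :=
  (∀ i, IsPositiveFunctional (ψ i)) ∧ ∑ i, ψ i = φ

/-- The Connes–Størmer relative entropy
`H(A|B) = sup_{(x_i)} ∑ᵢ (τ η E_B(x_i) - τ η E_A(x_i))`. -/
noncomputable def csEntropy (τ : Elem M →ₗ[ℂ] ℂ) (A B : VonNeumannAlgebra H) : EReal :=
  ⨆ (n : ℕ) (x : Fin n → Elem M) (_ : IsPartition x),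
    ((∑ i, ((τ (eta (condExp τ B (x i)))).re - (τ (eta (condExp τ A (x i)))).re) : ℝ) : EReal)

/-- The conditional (modified) relative entropy
`h(A|B) = sup_{(x_i)} ∑ᵢ (τ η E_B(E_A(x_i)) - τ η E_A(x_i))`. -/
noncomputable def condEntropy (τ : Elem M →ₗ[ℂ] ℂ) (A B : VonNeumannAlgebra H) : EReal :=
  ⨆ (n : ℕ) (x : Fin n → Elem M) (_ : IsPartition x),
    ((∑ i, ((τ (eta (condExp τ B (condExp τ A (x i))))).re
      - (τ (eta (condExp τ A (x i)))).re) : ℝ) : EReal)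

/-- Connes' relative entropy with respect to `φ`:
`H_φ(A|B) = sup_{(φ_i)} ∑ᵢ (S(φ_i|_A, φ|_A) - S(φ_i|_B, φ|_B))`. -/
noncomputable def csEntropyState {A B : VonNeumannAlgebra H} (hA : A ≤ M) (hB : B ≤ M)
    (φ : Elem M →ₗ[ℂ] ℂ) : EReal :=
  ⨆ (n : ℕ) (ψ : Fin n → (Elem M →ₗ[ℂ] ℂ)) (_ : IsDecomposition φ ψ),
    ∑ i, (relEntropy (restrict hA (ψ i)) (restrict hA φ)
      - relEntropy (restrict hB (ψ i)) (restrict hB φ))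

/-- The conditional relative entropy with respect to `φ`:
`h_φ(A|B) = sup_{(φ_i)} ∑ᵢ (S(φ_i|_A, φ|_A) - S((φ_i ∘ E_A)|_B, (φ ∘ E_A)|_B))`. -/
noncomputable def condEntropyState (τ : Elem M →ₗ[ℂ] ℂ) {A B : VonNeumannAlgebra H}
    (hA : A ≤ M) (hB : B ≤ M) (φ : Elem M →ₗ[ℂ] ℂ) : EReal :=
  ⨆ (n : ℕ) (ψ : Fin n → (Elem M →ₗ[ℂ] ℂ)) (_ : IsDecomposition φ ψ),
    ∑ i, (relEntropy (restrict hA (ψ i)) (restrict hA φ)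
      - relEntropy (restrict hB (ψ i ∘ₗ condExp τ A)) (restrict hB (φ ∘ₗ condExp τ A)))

end Entropies

end VNEntropy

/-!
# Entropy of commuting squares

Since `E_A` is idempotent, replacing a partition `(x_i)` by `(E_A x_i)`, or a decomposition `(φ_i)`
of `φ = φ ∘ E_A` by `(φ_i ∘ E_A)`, shows that the conditional entropies are at most the
Connes–Størmer ones. The reverse inequalities hold term by term.

* For partitions it is `τ η (E_B x) ≤ τ η (E_A E_B x) = τ η (E_B E_A x)`, which is Jensen's
  inequality for `E_A` (`IsTraceCondExp.eta_le`). It follows from the formula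
  `-s log s = ∫_0^∞ (s / (s + t) - s / (1 + t)) dt` (`integral_etaKernel`, `eta_eq_integral`) and
  from `τ((E y + t)⁻¹) ≤ τ((y + t)⁻¹)` (`IsTraceCondExp.resolv_le`). With `z = y + t` and
  `c = (E y + t)⁻¹`, the latter is positivity of `(1 - z c)* z⁻¹ (1 - z c)`.
* For decompositions it is `S((φ_i ∘ E_A)|_B, (φ ∘ E_A)|_B) ≤ S(φ_i|_B, φ|_B)`. By the commuting
  square condition `E_A` maps `B` into itself, and Kosaki's expression is monotone under unital
  Schwarz maps (`relEntropy_comp_le`): apply the map to the competing step function.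

All of this concerns actual conditional expectations, so their existence has to be established
(`exists_isTraceCondExp`). It amounts to finding, for a positive contraction `x ∈ M`, a positive
contraction `h ∈ A` with `τ(h a) = τ(x a)` for all `a ∈ A` (`exists_trace_representative`). The
functionals `τ(h ·)` form a weakly compact convex set, because the unit ball of `A` is weak operator
compact and `τ` is normal. A functional `τ(x ·)` outside it would be separated from it by some
self-adjoint `a ∈ A`, whereas `τ(x a) ≤ τ(a⁺) = sup_h τ(h a)`.
-/

namespace VNEntropy

/-! ### Relative entropy decreases under unital Schwarz maps -/

/-- Kosaki's expression is monotone under a unital linear map `α` satisfying the Schwarz inequality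
`α(x)* α(x) ≤ α(x* x)`, tested here only against the functionals at hand: a step function `x`
competing on the domain is turned into the competitor `α ∘ x`, which only decreases the
integrand. -/
theorem relEntropy_comp_le {C D : Type*} [Ring C] [StarRing C] [Algebra ℂ C]
    [Ring D] [StarRing D] [Algebra ℂ D] (α : C →ₗ[ℂ] D) (hα : α 1 = 1) (ψ φ : D →ₗ[ℂ] ℂ)
    (hψ : ∀ x, (ψ (star (α x) * α x)).re ≤ (ψ (α (star x * x))).re)
    (hφ : ∀ x, (φ (α x * star (α x))).re ≤ (φ (α (x * star x))).re) :
    relEntropy (ψ ∘ₗ α) (φ ∘ₗ α) ≤ relEntropy ψ φ := by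
  unfold relEntropy
  refine iSup_le fun n => iSup_le fun hn => iSup_le fun x => ?_
  refine le_iSup_of_le n (le_iSup_of_le hn (le_iSup_of_le (x.map α) ?_))
  refine EReal.sub_le_sub (by simp [hα]) ?_
  refine EReal.coe_ennreal_le_coe_ennreal_iff.2 ?_
  refine MeasureTheory.setLIntegral_mono' measurableSet_Ioi fun t ht => ?_
  have ht0 : 0 < t := lt_trans (by positivity) ht
  refine ENNReal.ofReal_le_ofReal ?_
  have h1 := hψ (1 - x t)
  have h2 := mul_le_mul_of_nonneg_left (hφ (x t)) (inv_nonneg.2 ht0.le)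
  simp only [map_sub, hα] at h1
  refine div_le_div_of_nonneg_right ?_ ht0.le
  simp only [MeasureTheory.SimpleFunc.map_apply, LinearMap.comp_apply]
  linarith

variable {H : Type*} [NormedAddCommGroup H] [InnerProductSpace ℂ H] [CompleteSpace H]
  {M : VonNeumannAlgebra H}

/-! ### Positive functionals -/

theorem isPositive_star_mul_mul {z : Elem M} (hz : (z : H →L[ℂ] H).IsPositive) (y : Elem M) :
    ((star y * z * y : Elem M) : H →L[ℂ] H).IsPositive := by
  have h := hz.adjoint_conj (y : H →L[ℂ] H)
  exact h

theorem isPositive_star_mul_self (y : Elem M) :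
    ((star y * y : Elem M) : H →L[ℂ] H).IsPositive := by
  simpa using isPositive_star_mul_mul (M := M) (z := 1) ContinuousLinearMap.isPositive_one y

theorem isSelfAdjoint_of_isPositive {x : Elem M} (hx : (x : H →L[ℂ] H).IsPositive) :
    star x = x :=
  Subtype.ext hx.isSelfAdjoint

theorem isPositive_real_smul {c : ℝ} (hc : 0 ≤ c) {x : Elem M}
    (hx : (x : H →L[ℂ] H).IsPositive) : (((c : ℂ) • x : Elem M) : H →L[ℂ] H).IsPositive :=
  hx.smul_of_nonneg (c := (c : ℂ)) (by exact_mod_cast hc)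

theorem isPositive_norm_sub {x : Elem M} (hx : star x = x) :
    ((((‖(x : H →L[ℂ] H)‖ : ℝ) : ℂ) • 1 - x : Elem M) : H →L[ℂ] H).IsPositive := by
  have hsa : IsSelfAdjoint (x : H →L[ℂ] H) := congrArg Subtype.val hx
  have h := hsa.le_algebraMap_norm_self
  rw [ContinuousLinearMap.le_def] at h
  convert h using 1
  ext v
  simp [Algebra.algebraMap_eq_smul_one]

theorem isPositive_norm_add {x : Elem M} (hx : star x = x) :
    ((((‖(x : H →L[ℂ] H)‖ : ℝ) : ℂ) • 1 + x : Elem M) : H →L[ℂ] H).IsPositive := by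
  have h := isPositive_norm_sub (x := -x) (by rw [star_neg, hx])
  simpa using h

namespace IsPositiveFunctional

variable {φ : Elem M →ₗ[ℂ] ℂ} (hφ : IsPositiveFunctional φ)
include hφ

theorem im_eq_zero {x : Elem M} (hx : star x = x) : (φ x).im = 0 := by
  have h := hφ _ (isPositive_norm_add hx)
  have h1 := hφ 1 ContinuousLinearMap.isPositive_one
  rw [map_add, map_smul] at h
  have h2 := (Complex.nonneg_iff.1 h).2
  have h3 := (Complex.nonneg_iff.1 h1).2
  simp [← h3] at h2
  exact h2.symm

/-- Positive functionals are Hermitian. -/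
theorem map_star (x : Elem M) : φ (star x) = star (φ x) := by
  have h1 := hφ.im_eq_zero (x := x + star x) (by rw [star_add, star_star, add_comm])
  have h2 := hφ.im_eq_zero (x := Complex.I • (x - star x)) (by
    rw [star_smul, star_sub, star_star]
    simp only [Complex.star_def, Complex.conj_I, smul_sub, neg_smul]
    abel)
  simp only [map_add, map_smul, map_sub] at h1 h2
  apply Complex.ext
  · simp at h2 ⊢
    linarith
  · simp at h1 ⊢
    linarith

end IsPositiveFunctional

/-! ### Conditional expectations -/

namespace IsTraceCondExp

variable {τ : Elem M →ₗ[ℂ] ℂ} {A : VonNeumannAlgebra H} {E : Elem M →ₗ[ℂ] Elem M}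
  (hE : IsTraceCondExp τ A E)
include hE

theorem map_one : E 1 = 1 := hE.map_of_mem 1 (one_mem A)

theorem idem (x : Elem M) : E (E x) = E x := hE.map_of_mem _ (hE.mem x)

theorem mul_left {a : Elem M} (ha : (a : H →L[ℂ] H) ∈ A) (x : Elem M) : E (a * x) = a * E x := by
  simpa using hE.bimodule a x 1 ha (one_mem A)

theorem mul_right {b : Elem M} (hb : (b : H →L[ℂ] H) ∈ A) (x : Elem M) : E (x * b) = E x * b := by
  simpa using hE.bimodule 1 x b (one_mem A) hb

theorem map_star (x : Elem M) : E (star x) = star (E x) := by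
  have hsa : ∀ z : Elem M, star z = z → star (E z) = E z := by
    intro z hz
    have h1 := isSelfAdjoint_of_isPositive (hE.positive _ (isPositive_norm_add hz))
    rw [map_add, map_smul, hE.map_one, star_add, star_smul, star_one] at h1
    simpa using h1
  have h1 := hsa (x + star x) (by rw [star_add, star_star, add_comm])
  have h2 := hsa (Complex.I • (x - star x)) (by
    rw [star_smul, star_sub, star_star]
    simp only [Complex.star_def, Complex.conj_I, smul_sub, neg_smul]
    abel)
  simp only [map_add, map_smul, map_sub, star_add, star_smul, star_sub] at h1 h2
  have h3 : star (E x) - star (E (star x)) = - (E x - E (star x)) := by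
    have h4 : Complex.I • (star (E x) - star (E (star x))) = Complex.I • (-(E x - E (star x))) := by
      rw [smul_neg, ← h2]
      simp
    exact smul_right_injective _ Complex.I_ne_zero h4
  have h5 : (2 : ℂ) • (star (E x)) = (2 : ℂ) • E (star x) := by
    calc (2 : ℂ) • star (E x) = (star (E x) + star (E (star x))) +
          (star (E x) - star (E (star x))) := by rw [two_smul]; abel
      _ = (2 : ℂ) • E (star x) := by rw [h1, h3, two_smul]; abel
  exact (smul_right_injective _ (two_ne_zero (α := ℂ)) h5).symm

/-- The Schwarz inequality `E(x)* E(x) ≤ E(x* x)`: the difference is `E((x - E x)* (x - E x))`. -/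
theorem schwarz (x : Elem M) :
    ((E (star x * x) - star (E x) * E x : Elem M) : H →L[ℂ] H).IsPositive := by
  have h := hE.positive _ (isPositive_star_mul_self (x - E x))
  have hs : ((star (E x) : Elem M) : H →L[ℂ] H) ∈ A := star_mem (hE.mem x)
  have h1 : E (star (x - E x) * (x - E x)) = E (star x * x) - star (E x) * E x := by
    rw [star_sub, sub_mul, mul_sub, mul_sub, map_sub, map_sub, map_sub,
      hE.mul_right (hE.mem x), hE.mul_left hs, hE.mul_left hs, hE.idem, hE.map_star]
    abel
  rwa [h1] at h

theorem comp_positive {φ : Elem M →ₗ[ℂ] ℂ} (hφ : IsPositiveFunctional φ) :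
    IsPositiveFunctional (φ ∘ₗ E) := fun x hx => hφ _ (hE.positive x hx)

theorem isPartition {n : ℕ} {x : Fin n → Elem M} (hx : IsPartition x) :
    IsPartition fun i => E (x i) :=
  ⟨fun i => hE.positive _ (hx.1 i), by rw [← map_sum, hx.2, hE.map_one]⟩

theorem restrict_comp (hA : A ≤ M) (φ : Elem M →ₗ[ℂ] ℂ) :
    restrict hA (φ ∘ₗ E) = restrict hA φ := by
  ext a
  exact congrArg φ (hE.map_of_mem _ a.2)

/-- The restrictions to `B` of `ψ ∘ E_A` and `φ ∘ E_A` have smaller relative entropy than those of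
`ψ` and `φ`, as soon as `E_A` maps `B` into itself. -/
theorem relEntropy_restrict_comp_le {B : VonNeumannAlgebra H} (hB : B ≤ M)
    (hEB : ∀ b : Elem M, (b : H →L[ℂ] H) ∈ B → (E b : H →L[ℂ] H) ∈ B)
    {ψ φ : Elem M →ₗ[ℂ] ℂ} (hψ : IsPositiveFunctional ψ) (hφ : IsPositiveFunctional φ) :
    relEntropy (restrict hB (ψ ∘ₗ E)) (restrict hB (φ ∘ₗ E)) ≤
      relEntropy (restrict hB ψ) (restrict hB φ) := by
  let ι : Elem B →ₗ[ℂ] Elem M := (StarSubalgebra.inclusion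
    (show B.toStarSubalgebra ≤ M.toStarSubalgebra from fun _ hx => hB hx)).toAlgHom.toLinearMap
  let α : Elem B →ₗ[ℂ] Elem B :=
    { toFun := fun b => ⟨E (ι b), hEB _ b.2⟩
      map_add' := fun x y => Subtype.ext (by simp)
      map_smul' := fun c x => Subtype.ext (by simp) }
  have key : ∀ {θ : Elem M →ₗ[ℂ] ℂ}, IsPositiveFunctional θ → ∀ x : Elem M,
      (θ (star (E x) * E x)).re ≤ (θ (E (star x * x))).re := by
    intro θ hθ x
    have h := (Complex.nonneg_iff.1 (hθ _ (hE.schwarz x))).1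
    rw [map_sub, Complex.sub_re] at h
    linarith
  refine relEntropy_comp_le α
    (Subtype.ext (congrArg (fun z : Elem M => (z : H →L[ℂ] H)) hE.map_one)) (restrict hB ψ)
    (restrict hB φ) (fun x => key hψ (ι x)) fun x => ?_
  have h := key hφ (star (ι x))
  rw [hE.map_star, star_star, star_star] at h
  exact h

end IsTraceCondExp

/-! ### Comparison of the entropies with respect to a state -/

theorem csEntropyState_eq_condEntropyState {τ : Elem M →ₗ[ℂ] ℂ} {A B : VonNeumannAlgebra H}
    (hA : A ≤ M) (hB : B ≤ M) (hE : IsTraceCondExp τ A (condExp τ A))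
    (hEB : ∀ b : Elem M, (b : H →L[ℂ] H) ∈ B → (condExp τ A b : H →L[ℂ] H) ∈ B)
    {φ : Elem M →ₗ[ℂ] ℂ} (hφ : IsPositiveFunctional φ) (hφA : φ = φ ∘ₗ condExp τ A) :
    csEntropyState hA hB φ = condEntropyState τ hA hB φ := by
  apply le_antisymm
  · refine iSup_le fun n => iSup_le fun ψ => iSup_le fun hψ => ?_
    refine le_iSup_of_le n (le_iSup_of_le ψ (le_iSup_of_le hψ ?_))
    exact Finset.sum_le_sum fun i _ =>
      EReal.sub_le_sub le_rfl (hE.relEntropy_restrict_comp_le hB hEB (hψ.1 i) hφ)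
  · refine iSup_le fun n => iSup_le fun ψ => iSup_le fun hψ => ?_
    have hψ' : IsDecomposition φ fun i => ψ i ∘ₗ condExp τ A := by
      refine ⟨fun i => hE.comp_positive (hψ.1 i), ?_⟩
      ext x
      conv_rhs => rw [hφA, ← hψ.2]
      simp
    refine le_iSup_of_le n (le_iSup_of_le _ (le_iSup_of_le hψ' (le_of_eq ?_)))
    simp only [hE.restrict_comp hA, ← hφA]

/-! ### Normal functionals -/

theorem summable_norm_mul_norm {V : Type*} [NormedAddCommGroup V] {ξ η : ℕ → V}
    (hξ : Summable fun n => ‖ξ n‖ ^ 2)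
    (hη : Summable fun n => ‖η n‖ ^ 2) : Summable fun n => ‖ξ n‖ * ‖η n‖ :=
  Summable.of_nonneg_of_le (fun n => by positivity)
    (fun n => by nlinarith [sq_nonneg (‖ξ n‖ - ‖η n‖), sq_nonneg (‖ξ n‖), sq_nonneg (‖η n‖)])
    (hξ.add hη)

theorem norm_inner_apply_le {V : Type*} [NormedAddCommGroup V] [InnerProductSpace ℂ V]
    (x : V →L[ℂ] V) (ξ η : V) : ‖⟪ξ, x η⟫_ℂ‖ ≤ ‖x‖ * (‖ξ‖ * ‖η‖) :=
  calc ‖⟪ξ, x η⟫_ℂ‖ ≤ ‖ξ‖ * ‖x η‖ := norm_inner_le_norm _ _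
    _ ≤ ‖ξ‖ * (‖x‖ * ‖η‖) := by gcongr; exact x.le_opNorm η
    _ = ‖x‖ * (‖ξ‖ * ‖η‖) := by ring

/-- A normal functional extends to a bounded functional on all bounded operators. -/
theorem IsNormalFunctional.exists_extension {φ : Elem M →ₗ[ℂ] ℂ} (hφ : IsNormalFunctional φ) :
    ∃ T : (H →L[ℂ] H) →L[ℂ] ℂ, ∀ x : Elem M, T x = φ x := by
  obtain ⟨ξ, η, hξ, hη, h⟩ := hφ
  have hs := summable_norm_mul_norm hξ hη
  have hsum : ∀ x : H →L[ℂ] H, Summable fun n => ⟪ξ n, x (η n)⟫_ℂ := fun x =>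
    Summable.of_norm_bounded (hs.mul_left ‖x‖) fun n => norm_inner_apply_le x _ _
  let f : (H →L[ℂ] H) →ₗ[ℂ] ℂ :=
    { toFun := fun x => ∑' n, ⟪ξ n, x (η n)⟫_ℂ
      map_add' := fun x y => by
        rw [← (hsum x).tsum_add (hsum y)]
        simp
      map_smul' := fun c x => by
        rw [RingHom.id_apply, smul_eq_mul, ← tsum_mul_left]
        simp }
  refine ⟨f.mkContinuous (∑' n, ‖ξ n‖ * ‖η n‖) fun x => ?_, fun x => (h x).tsum_eq⟩
  rw [mul_comm, ← tsum_mul_left]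
  exact tsum_of_norm_bounded (hs.mul_left ‖x‖).hasSum fun n => norm_inner_apply_le x _ _

/-! ### The entropy function as an integral of resolvents -/

/-- The integrand of `-s log s = ∫_0^∞ (s / (s + t) - s / (1 + t)) dt`. -/
noncomputable def etaKernel (t s : ℝ) : ℝ := s / (s + t) - s / (1 + t)

/-- The kernel is `O(t⁻²)` at infinity and bounded near `0`, uniformly for `s ∈ [0, R]`. -/
theorem abs_etaKernel_le {R s t : ℝ} (hs : 0 ≤ s) (hsR : s ≤ R) (ht : 0 < t) :
    |etaKernel t s| ≤ (1 + R) ^ 2 * (2 * (1 + t ^ 2)⁻¹) := by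
  have h1 : etaKernel t s = s * (1 - s) / ((s + t) * (1 + t)) := by
    unfold etaKernel
    field_simp
    ring
  rw [h1, abs_div, abs_of_pos (show 0 < (s + t) * (1 + t) by positivity), abs_mul, abs_of_nonneg hs,
    div_le_iff₀ (by positivity), ← div_eq_mul_inv, mul_div_assoc', div_mul_eq_mul_div,
    le_div_iff₀ (by positivity)]
  have h2 : |1 - s| ≤ 1 + R := abs_le.2 ⟨by linarith, by linarith⟩
  have h3 : s * (1 + t ^ 2) ≤ (1 + R) * (2 * ((s + t) * (1 + t))) := by
    nlinarith [mul_nonneg hs ht.le, mul_nonneg hs (sq_nonneg t), mul_pos ht ht,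
      mul_nonneg (hs.trans hsR) (mul_nonneg hs ht.le), mul_nonneg (hs.trans hsR) hs,
      mul_nonneg (hs.trans hsR) (mul_nonneg ht.le ht.le), mul_nonneg (hs.trans hsR) ht.le,
      mul_nonneg (sub_nonneg.2 hsR) (sq_nonneg t)]
  calc s * |1 - s| * (1 + t ^ 2) = |1 - s| * (s * (1 + t ^ 2)) := by ring
    _ ≤ (1 + R) * ((1 + R) * (2 * ((s + t) * (1 + t)))) := by
        have : 0 ≤ 1 + R := by linarith
        gcongr
    _ = _ := by ring

theorem continuousOn_etaKernel :
    ContinuousOn (Function.uncurry etaKernel) (Set.Ioi 0 ×ˢ Set.Ici 0) := by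
  have : Function.uncurry etaKernel =
      fun p : ℝ × ℝ => p.2 / (p.2 + p.1) - p.2 / (1 + p.1) := rfl
  rw [this]
  refine ContinuousOn.sub (ContinuousOn.div (by fun_prop) (by fun_prop) ?_)
    (ContinuousOn.div (by fun_prop) (by fun_prop) ?_)
  · rintro ⟨t, s⟩ ⟨ht, hs⟩
    exact (add_pos_of_nonneg_of_pos hs ht).ne'
  · rintro ⟨t, s⟩ ⟨ht, hs⟩
    exact (add_pos one_pos ht).ne'

theorem integrableOn_bound (R : ℝ) :
    MeasureTheory.IntegrableOn (fun t : ℝ => (1 + R) ^ 2 * (2 * (1 + t ^ 2)⁻¹)) (Set.Ioi 0) :=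
  ((integrable_inv_one_add_sq.const_mul 2).const_mul _).integrableOn

theorem integral_etaKernel {s : ℝ} (hs : 0 ≤ s) :
    ∫ t in Set.Ioi (0 : ℝ), etaKernel t s = Real.negMulLog s := by
  rcases hs.eq_or_lt with rfl | hs
  · simp [etaKernel]
  have hint : MeasureTheory.IntegrableOn (fun t => etaKernel t s) (Set.Ioi 0) := by
    refine MeasureTheory.Integrable.mono' (integrableOn_bound s) ?_ ?_
    · refine ContinuousOn.aestronglyMeasurable ?_ measurableSet_Ioi
      exact continuousOn_etaKernel.comp (f := fun t : ℝ => (t, s)) (by fun_prop)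
        fun t ht => ⟨ht, hs.le⟩
    · refine (MeasureTheory.ae_restrict_iff' measurableSet_Ioi).2 (.of_forall fun t ht => ?_)
      exact abs_etaKernel_le hs.le le_rfl ht
  have hd : ∀ t ∈ Set.Ici (0 : ℝ),
      HasDerivAt (fun t => s * (Real.log (s + t) - Real.log (1 + t))) (etaKernel t s) t := by
    intro t ht
    have ht' : 0 ≤ t := ht
    have h1 : HasDerivAt (fun t => Real.log (s + t)) (1 / (s + t)) t :=
      ((hasDerivAt_id t).const_add s).log (by simp; positivity)
    have h2 : HasDerivAt (fun t => Real.log (1 + t)) (1 / (1 + t)) t :=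
      ((hasDerivAt_id t).const_add 1).log (by simp; positivity)
    refine ((h1.sub h2).const_mul s).congr_deriv ?_
    unfold etaKernel
    ring
  have hlim : Filter.Tendsto (fun t => s * (Real.log (s + t) - Real.log (1 + t))) Filter.atTop
      (nhds (s * Real.log 1)) := by
    have h1 : Filter.Tendsto (fun t : ℝ => 1 + (s - 1) / (1 + t)) Filter.atTop (nhds (1 + 0)) :=
      tendsto_const_nhds.add (tendsto_const_nhds.div_atTop
        (Filter.tendsto_atTop_add_const_left _ _ Filter.tendsto_id))
    rw [add_zero] at h1
    have h2 := ((Real.continuousAt_log one_ne_zero).tendsto.comp h1).const_mul s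
    refine h2.congr' ?_
    filter_upwards [Filter.eventually_gt_atTop 0] with t ht
    rw [← Real.log_div (by positivity) (by positivity)]
    simp only [Function.comp]
    congr 2
    field_simp
    ring
  rw [MeasureTheory.integral_Ioi_of_hasDerivAt_of_tendsto
    (hd 0 Set.self_mem_Ici).continuousAt.continuousWithinAt
    (fun t ht => hd t (Set.mem_Ici_of_Ioi ht)) hint hlim]
  simp [Real.negMulLog]

/-! ### Jensen's inequality for conditional expectations -/

/-- `f(x)` for `x ∈ M`, by functional calculus. -/
noncomputable def elemCfc (f : ℝ → ℝ) (x : Elem M) : Elem M :=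
  ⟨cfc f (x : H →L[ℂ] H), cfc_mem M f x.2⟩

theorem spectrum_bounds {y : H →L[ℂ] H} (hy : y.IsPositive) {s : ℝ} (hs : s ∈ spectrum ℝ y) :
    0 ≤ s ∧ s ≤ ‖y‖ * ‖(1 : H →L[ℂ] H)‖ :=
  ⟨spectrum_nonneg_of_nonneg ((ContinuousLinearMap.nonneg_iff_isPositive y).2 hy) hs,
    (le_abs_self s).trans (spectrum.norm_le_norm_mul_of_mem hs)⟩

/-- The integral formula for `-s log s` carried through the functional calculus and `τ`, the latter
being norm continuous by normality. -/
theorem eta_eq_integral {τ : Elem M →ₗ[ℂ] ℂ} (hτ : IsNormalFunctional τ) {y : Elem M}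
    (hy : (y : H →L[ℂ] H).IsPositive) :
    MeasureTheory.IntegrableOn (fun t => (τ (elemCfc (etaKernel t) y)).re) (Set.Ioi 0) ∧
      ∫ t in Set.Ioi (0 : ℝ), (τ (elemCfc (etaKernel t) y)).re = (τ (eta y)).re := by
  obtain ⟨T, hT⟩ := hτ.exists_extension
  have hsa : IsSelfAdjoint (y : H →L[ℂ] H) := hy.isSelfAdjoint
  have hc : ContinuousOn (Function.uncurry etaKernel)
      (Set.Ioi 0 ×ˢ spectrum ℝ (y : H →L[ℂ] H)) :=
    continuousOn_etaKernel.mono (Set.prod_mono_right fun s hs => (spectrum_bounds hy hs).1)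
  have hb : ∀ᵐ t ∂(MeasureTheory.volume.restrict (Set.Ioi (0 : ℝ))),
      ∀ s ∈ spectrum ℝ (y : H →L[ℂ] H), ‖etaKernel t s‖ ≤
        (1 + ‖(y : H →L[ℂ] H)‖ * ‖(1 : H →L[ℂ] H)‖) ^ 2 * (2 * (1 + t ^ 2)⁻¹) :=
    (MeasureTheory.ae_restrict_iff' measurableSet_Ioi).2 <| .of_forall fun t ht s hs =>
      abs_etaKernel_le (spectrum_bounds hy hs).1 (spectrum_bounds hy hs).2 ht
  have hfin := (integrableOn_bound (‖(y : H →L[ℂ] H)‖ * ‖(1 : H →L[ℂ] H)‖)).hasFiniteIntegral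
  have hint := integrableOn_cfc measurableSet_Ioi etaKernel _ (y : H →L[ℂ] H) hc hb hfin hsa
  have heq := cfc_setIntegral measurableSet_Ioi etaKernel _ (y : H →L[ℂ] H) hc hb hfin hsa
  have hcongr : cfc (fun r => ∫ t in Set.Ioi (0 : ℝ), etaKernel t r) (y : H →L[ℂ] H) =
      cfc Real.negMulLog (y : H →L[ℂ] H) :=
    cfc_congr fun s hs => integral_etaKernel (spectrum_bounds hy hs).1
  have hre : ∀ t, (τ (elemCfc (etaKernel t) y)).re =
      (Complex.reCLM.comp (T.restrictScalars ℝ)) (cfc (etaKernel t) (y : H →L[ℂ] H)) := by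
    intro t
    rw [← hT]
    rfl
  simp_rw [hre]
  refine ⟨ContinuousLinearMap.integrable_comp _ hint, ?_⟩
  rw [ContinuousLinearMap.integral_comp_comm _ hint, ← heq, hcongr]
  exact congrArg Complex.re (hT (eta y))

/-- `(y + t)⁻¹` for a positive `y` and `t > 0`. -/
noncomputable def resolv (t : ℝ) (y : Elem M) : Elem M := elemCfc (fun s => (s + t)⁻¹) y

section Resolvent

variable {y : Elem M} (hy : (y : H →L[ℂ] H).IsPositive) {t : ℝ} (ht : 0 < t)
include hy ht

theorem continuousOn_inv_add :
    ContinuousOn (fun s : ℝ => (s + t)⁻¹) (spectrum ℝ (y : H →L[ℂ] H)) := by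
  refine ContinuousOn.inv₀ (by fun_prop) fun s hs => ?_
  have := (spectrum_bounds hy hs).1
  positivity

theorem resolv_isPositive : (resolv t y : H →L[ℂ] H).IsPositive := by
  rw [← ContinuousLinearMap.nonneg_iff_isPositive]
  refine cfc_nonneg fun s hs => ?_
  have := (spectrum_bounds hy hs).1
  positivity

theorem add_mul_resolv : (y + (t : ℂ) • 1) * resolv t y = 1 := by
  have hsa : IsSelfAdjoint (y : H →L[ℂ] H) := hy.isSelfAdjoint
  have h1 : cfc (fun s : ℝ => s + t) (y : H →L[ℂ] H) = y + (t : ℂ) • (1 : H →L[ℂ] H) := by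
    rw [cfc_add_const t (fun s => s) _ (by fun_prop) hsa, cfc_id' ℝ (y : H →L[ℂ] H) hsa,
      Algebra.algebraMap_eq_smul_one]
    rfl
  have h2 : cfc (fun s : ℝ => s + t) (y : H →L[ℂ] H) *
      cfc (fun s : ℝ => (s + t)⁻¹) (y : H →L[ℂ] H) = 1 := by
    rw [← cfc_mul _ _ _ (by fun_prop) (continuousOn_inv_add hy ht)]
    rw [cfc_congr (g := fun _ => 1), cfc_const_one ℝ (y : H →L[ℂ] H) hsa]
    intro s hs
    have := (spectrum_bounds hy hs).1
    exact mul_inv_cancel₀ (by positivity)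
  rw [h1] at h2
  exact Subtype.ext h2

theorem resolv_mul_add : resolv t y * (y + (t : ℂ) • 1) = 1 := by
  have h := congrArg star (add_mul_resolv hy ht)
  rwa [star_mul, star_add, star_smul, star_one, isSelfAdjoint_of_isPositive hy,
    isSelfAdjoint_of_isPositive (resolv_isPositive hy ht), Complex.star_def,
    Complex.conj_ofReal] at h

theorem elemCfc_etaKernel :
    elemCfc (etaKernel t) y = 1 - (t : ℂ) • resolv t y - (((1 + t)⁻¹ : ℝ) : ℂ) • y := by
  have hsa : IsSelfAdjoint (y : H →L[ℂ] H) := hy.isSelfAdjoint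
  have hc := continuousOn_inv_add hy ht
  have h1 : cfc (etaKernel t) (y : H →L[ℂ] H) =
      cfc (fun s => 1 - t * (s + t)⁻¹ - (1 + t)⁻¹ * s) (y : H →L[ℂ] H) := by
    refine cfc_congr fun s hs => ?_
    have := (spectrum_bounds hy hs).1
    simp only [etaKernel]
    field_simp
    ring
  rw [cfc_sub (fun s => 1 - t * (s + t)⁻¹) (fun s => (1 + t)⁻¹ * s) _
      (continuousOn_const.sub (continuousOn_const.mul hc)) (by fun_prop),
    cfc_sub (fun _ => 1) (fun s => t * (s + t)⁻¹) _ continuousOn_const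
      (continuousOn_const.mul hc),
    cfc_const_mul t (fun s => (s + t)⁻¹) _ hc, cfc_const_mul _ (fun s => s) _ (by fun_prop),
    cfc_const_one ℝ (y : H →L[ℂ] H) hsa, cfc_id' ℝ (y : H →L[ℂ] H) hsa] at h1
  exact Subtype.ext h1

end Resolvent

/-- Jensen's inequality for the operator convex function `s ↦ (s + t)⁻¹`, under the trace. -/
theorem IsTraceCondExp.resolv_le {τ : Elem M →ₗ[ℂ] ℂ} (hτ : IsPositiveFunctional τ)
    {A : VonNeumannAlgebra H} {E : Elem M →ₗ[ℂ] Elem M} (hE : IsTraceCondExp τ A E) {y : Elem M}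
    (hy : (y : H →L[ℂ] H).IsPositive) {t : ℝ} (ht : 0 < t) :
    (τ (resolv t (E y))).re ≤ (τ (resolv t y)).re := by
  have hb := hE.positive y hy
  set c := resolv t (E y) with hc
  set z := y + (t : ℂ) • (1 : Elem M) with hz
  have hcA : (c : H →L[ℂ] H) ∈ A := cfc_mem A _ (hE.mem y)
  have hcs : star c = c := isSelfAdjoint_of_isPositive (resolv_isPositive hb ht)
  have hzs : star z = z := by
    rw [hz, star_add, star_smul, star_one, isSelfAdjoint_of_isPositive hy, Complex.star_def,
      Complex.conj_ofReal]
  -- `z⁻¹ - 2 c + c z c = (1 - z c)* z⁻¹ (1 - z c)` is positive, and the trace of `c z c` is that of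
  -- `c (E z) c = c`.
  have h1 : star (1 - z * c) * resolv t y * (1 - z * c) = resolv t y - c - c + c * z * c := by
    have h2 : resolv t y * z = 1 := resolv_mul_add hy ht
    have h3 : z * resolv t y = 1 := add_mul_resolv hy ht
    rw [star_sub, star_one, star_mul, hcs, hzs]
    calc (1 - c * z) * resolv t y * (1 - z * c)
        = resolv t y - (resolv t y * z) * c - c * (z * resolv t y)
          + c * (z * resolv t y) * z * c := by noncomm_ring
      _ = _ := by rw [h2, h3]; noncomm_ring
  have h2 := (Complex.nonneg_iff.1
    (hτ _ (isPositive_star_mul_mul (resolv_isPositive hy ht) (1 - z * c)))).1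
  have h3 : τ (c * z * c) = τ c := by
    rw [← hE.trace (c * z * c), hE.bimodule c z c hcA hcA, hz, map_add, map_smul, hE.map_one, hc,
      resolv_mul_add hb ht, one_mul]
  rw [h1] at h2
  simp only [map_add, map_sub, h3, Complex.add_re, Complex.sub_re] at h2
  linarith

/-- The trace of `η` does not decrease under the conditional expectation. -/
theorem IsTraceCondExp.eta_le {τ : Elem M →ₗ[ℂ] ℂ} (hτ : IsPositiveFunctional τ)
    (hn : IsNormalFunctional τ) {A : VonNeumannAlgebra H} {E : Elem M →ₗ[ℂ] Elem M}
    (hE : IsTraceCondExp τ A E) {y : Elem M} (hy : (y : H →L[ℂ] H).IsPositive) :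
    (τ (eta y)).re ≤ (τ (eta (E y))).re := by
  obtain ⟨hi1, h1⟩ := eta_eq_integral hn hy
  obtain ⟨hi2, h2⟩ := eta_eq_integral hn (hE.positive y hy)
  rw [← h1, ← h2]
  refine MeasureTheory.setIntegral_mono_on hi1 hi2 measurableSet_Ioi fun t ht => ?_
  rw [elemCfc_etaKernel hy ht, elemCfc_etaKernel (hE.positive y hy) ht]
  have h := mul_le_mul_of_nonneg_left (hE.resolv_le hτ hy ht) (le_of_lt (Set.mem_Ioi.1 ht))
  simp only [map_sub, map_smul, hE.trace, smul_eq_mul, Complex.sub_re, Complex.re_ofReal_mul]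
  linarith

/-! ### Comparison of the tracial entropies -/

theorem csEntropy_eq_condEntropy {τ : Elem M →ₗ[ℂ] ℂ} (hτ : IsPositiveFunctional τ)
    (hn : IsNormalFunctional τ) {A B : VonNeumannAlgebra H}
    (hA : IsTraceCondExp τ A (condExp τ A)) (hB : IsTraceCondExp τ B (condExp τ B))
    (hcomm : ∀ x, condExp τ A (condExp τ B x) = condExp τ B (condExp τ A x)) :
    csEntropy τ A B = condEntropy τ A B := by
  apply le_antisymm
  · refine iSup_le fun n => iSup_le fun x => iSup_le fun hx => ?_
    refine le_iSup_of_le n (le_iSup_of_le x (le_iSup_of_le hx ?_))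
    refine EReal.coe_le_coe_iff.2 (Finset.sum_le_sum fun i _ => sub_le_sub_right ?_ _)
    rw [← hcomm]
    exact hA.eta_le hτ hn (hB.positive _ (hx.1 i))
  · refine iSup_le fun n => iSup_le fun x => iSup_le fun hx => ?_
    refine le_iSup_of_le n (le_iSup_of_le _ (le_iSup_of_le (hA.isPartition hx) (le_of_eq ?_)))
    simp only [hA.idem]

/-! ### Weak limits in a von Neumann algebra -/

theorem norm_le_one_of_isPositive {x : H →L[ℂ] H} (h0 : x.IsPositive) (h1 : (1 - x).IsPositive) :
    ‖x‖ ≤ 1 := by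
  have h0' := (ContinuousLinearMap.nonneg_iff_isPositive x).2 h0
  have h1' : x ≤ 1 := (ContinuousLinearMap.le_def x 1).2 h1
  rcases subsingleton_or_nontrivial H with hH | hH
  · rw [Subsingleton.elim x 0]
    simp
  · exact (CStarAlgebra.norm_le_one_iff_of_nonneg x).2 h1'

/-- Bounded nets of operators have weak operator limits along ultrafilters. -/
theorem exists_weak_limit {ι : Type*} (U : Ultrafilter ι) (x : ι → H →L[ℂ] H)
    (hx : ∀ᶠ i in (U : Filter ι), ‖x i‖ ≤ 1) :
    ∃ T : H →L[ℂ] H, ∀ ξ η : H,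
      Filter.Tendsto (fun i => ⟪ξ, x i η⟫_ℂ) U (nhds ⟪ξ, T η⟫_ℂ) := by
  have hbd : ∀ ξ η : H, ∀ᶠ i in (U : Filter ι),
      ⟪x i ξ, η⟫_ℂ ∈ Metric.closedBall (0 : ℂ) (‖ξ‖ * ‖η‖) := fun ξ η => by
    filter_upwards [hx] with i hi
    rw [mem_closedBall_zero_iff]
    refine (norm_inner_le_norm _ _).trans ?_
    gcongr
    exact ((x i).le_of_opNorm_le hi ξ).trans_eq (one_mul _)
  have hlim : ∀ ξ η : H, ∃ c ∈ Metric.closedBall (0 : ℂ) (‖ξ‖ * ‖η‖),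
      Filter.Tendsto (fun i => ⟪x i ξ, η⟫_ℂ) U (nhds c) := fun ξ η =>
    isCompact_iff_ultrafilter_le_nhds.1 (isCompact_closedBall (0 : ℂ) (‖ξ‖ * ‖η‖))
      (U.map fun i => ⟪x i ξ, η⟫_ℂ) (Filter.le_principal_iff.2 (hbd ξ η))
  choose b hb hbl using hlim
  let f : H →ₗ⋆[ℂ] H →ₗ[ℂ] ℂ := LinearMap.mk₂'ₛₗ (starRingEnd ℂ) (RingHom.id ℂ) b
    (fun ξ ξ' η => tendsto_nhds_unique (hbl (ξ + ξ') η)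
      (by simpa [inner_add_left] using (hbl ξ η).add (hbl ξ' η)))
    (fun c ξ η => tendsto_nhds_unique (hbl (c • ξ) η)
      (by simpa [inner_smul_left, mul_comm] using (hbl ξ η).const_mul (starRingEnd ℂ c)))
    (fun ξ η η' => tendsto_nhds_unique (hbl ξ (η + η'))
      (by simpa [inner_add_right] using (hbl ξ η).add (hbl ξ η')))
    (fun c ξ η => tendsto_nhds_unique (hbl ξ (c • η))
      (by simpa [inner_smul_right] using (hbl ξ η).const_mul c))
  let B : H →L⋆[ℂ] H →L[ℂ] ℂ := f.mkContinuous₂ 1 fun ξ η => by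
    rw [one_mul]
    exact mem_closedBall_zero_iff.1 (hb ξ η)
  refine ⟨InnerProductSpace.continuousLinearMapOfBilin B, fun ξ η => ?_⟩
  have h := (hbl η ξ).star
  have h1 : ⟪InnerProductSpace.continuousLinearMapOfBilin B η, ξ⟫_ℂ = b η ξ :=
    InnerProductSpace.continuousLinearMapOfBilin_apply B η ξ
  rw [← h1] at h
  simpa only [Complex.star_def, inner_conj_symm] using h

/-- A von Neumann algebra, being a commutant, is closed under weak operator limits. -/
theorem mem_of_weak_limit {A : VonNeumannAlgebra H} {ι : Type*} {U : Filter ι} [U.NeBot]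
    {x : ι → H →L[ℂ] H} {T : H →L[ℂ] H}
    (hT : ∀ ξ η : H, Filter.Tendsto (fun i => ⟪ξ, x i η⟫_ℂ) U (nhds ⟪ξ, T η⟫_ℂ))
    (hx : ∀ᶠ i in U, x i ∈ A) : T ∈ A := by
  rw [← VonNeumannAlgebra.commutant_commutant A, VonNeumannAlgebra.mem_commutant_iff]
  intro g hg
  rw [VonNeumannAlgebra.mem_commutant_iff] at hg
  ext η
  refine ext_inner_left ℂ fun ξ => ?_
  have h1 := hT (ContinuousLinearMap.adjoint g ξ) η
  have h2 := hT ξ (g η)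
  simp only [ContinuousLinearMap.adjoint_inner_left] at h1
  refine tendsto_nhds_unique h1 (h2.congr' ?_)
  filter_upwards [hx] with i hi
  exact congrArg (fun z : H →L[ℂ] H => ⟪ξ, z η⟫_ℂ) (hg _ hi)

theorem isPositive_of_weak_limit {V : Type*} [NormedAddCommGroup V] [InnerProductSpace ℂ V]
    {ι : Type*} {U : Filter ι} [U.NeBot] {x : ι → V →L[ℂ] V} {T : V →L[ℂ] V}
    (hT : ∀ ξ η : V, Filter.Tendsto (fun i => ⟪ξ, x i η⟫_ℂ) U (nhds ⟪ξ, T η⟫_ℂ))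
    (hx : ∀ᶠ i in U, (x i).IsPositive) : T.IsPositive := by
  have h0 : ∀ ξ, 0 ≤ ⟪ξ, T ξ⟫_ℂ := fun ξ =>
    isClosed_Ici.mem_of_tendsto (hT ξ ξ) (hx.mono fun i hi => hi.inner_nonneg_right ξ)
  rw [ContinuousLinearMap.isPositive_iff_complex]
  intro ξ
  have h1 : 0 ≤ ⟪T ξ, ξ⟫_ℂ := by
    rw [← inner_conj_symm]
    exact star_nonneg_iff.2 (h0 ξ)
  obtain ⟨h2, h3⟩ := Complex.nonneg_iff.1 h1
  exact ⟨Complex.ext (by simp) (by simpa using h3), h2⟩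

/-- A normal functional is weak operator continuous on bounded sets. -/
theorem IsNormalFunctional.tendsto {φ : Elem M →ₗ[ℂ] ℂ} (hφ : IsNormalFunctional φ)
    {ι : Type*} {U : Filter ι} {x : ι → Elem M} {T : Elem M}
    (hT : ∀ ξ η : H, Filter.Tendsto (fun i => ⟪ξ, (x i : H →L[ℂ] H) η⟫_ℂ) U
      (nhds ⟪ξ, (T : H →L[ℂ] H) η⟫_ℂ))
    {C : ℝ} (hx : ∀ᶠ i in U, ‖(x i : H →L[ℂ] H)‖ ≤ C) :
    Filter.Tendsto (fun i => φ (x i)) U (nhds (φ T)) := by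
  obtain ⟨ξ, η, hξ, hη, h⟩ := hφ
  simp_rw [← (h _).tsum_eq]
  refine tendsto_tsum_of_dominated_convergence ((summable_norm_mul_norm hξ hη).mul_left C)
    (fun n => hT _ _) ?_
  filter_upwards [hx] with i hi n
  refine (norm_inner_apply_le _ _ _).trans ?_
  gcongr

/-! ### Existence of the conditional expectation -/

/-- For a tracial positive functional `τ(x p) ≥ 0` for positive `x` and `p`. -/
theorem trace_mul_nonneg {τ : Elem M →ₗ[ℂ] ℂ} (hτ : IsPositiveFunctional τ)
    (htr : ∀ x y, τ (x * y) = τ (y * x)) {x p : Elem M} (hx : (x : H →L[ℂ] H).IsPositive)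
    (hp : (p : H →L[ℂ] H).IsPositive) : 0 ≤ τ (x * p) := by
  have hsa : IsSelfAdjoint (p : H →L[ℂ] H) := hp.isSelfAdjoint
  have hr : elemCfc Real.sqrt p * elemCfc Real.sqrt p = p := by
    apply Subtype.ext
    change cfc Real.sqrt (p : H →L[ℂ] H) * cfc Real.sqrt (p : H →L[ℂ] H) = p
    rw [← cfc_mul _ _ _ (by fun_prop) (by fun_prop)]
    conv_rhs => rw [← cfc_id' ℝ (p : H →L[ℂ] H) hsa]
    exact cfc_congr fun s hs => Real.mul_self_sqrt (spectrum_bounds hp hs).1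
  have hs : star (elemCfc Real.sqrt p) = elemCfc Real.sqrt p :=
    Subtype.ext (cfc_predicate (R := ℝ) Real.sqrt (p : H →L[ℂ] H))
  have h := hτ _ (isPositive_star_mul_mul hx (elemCfc Real.sqrt p))
  rw [hs, htr, ← mul_assoc, hr, htr] at h
  exact h

theorem elemCfc_isPositive {a : Elem M} {f : ℝ → ℝ} (hf : ∀ s, 0 ≤ f s) :
    (elemCfc f a : H →L[ℂ] H).IsPositive := by
  rw [← ContinuousLinearMap.nonneg_iff_isPositive]
  exact cfc_nonneg fun s _ => hf s

theorem one_sub_elemCfc {a : Elem M} (ha : star a = a) {f : ℝ → ℝ} (hf : Continuous f) :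
    1 - elemCfc f a = elemCfc (fun s => 1 - f s) a := by
  have hsa : IsSelfAdjoint (a : H →L[ℂ] H) := congrArg Subtype.val ha
  apply Subtype.ext
  change 1 - cfc f (a : H →L[ℂ] H) = cfc (fun s => 1 - f s) (a : H →L[ℂ] H)
  rw [cfc_sub (fun _ => 1) f _ (by fun_prop) hf.continuousOn,
    cfc_const_one ℝ (a : H →L[ℂ] H) hsa]

/-- For self-adjoint `a` the supremum of `τ(h a)` over `0 ≤ h ≤ 1` in the C*-algebra
generated by `a` is the trace of the positive part of `a`, hence dominates `τ(x a)` for every `0 ≤ x ≤ 1` in `M`. -/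
theorem exists_trace_mul_le {τ : Elem M →ₗ[ℂ] ℂ} (hτ : IsPositiveFunctional τ)
    (htr : ∀ x y, τ (x * y) = τ (y * x)) {A : VonNeumannAlgebra H} {a : Elem M} (ha : star a = a)
    (haA : (a : H →L[ℂ] H) ∈ A) {x : Elem M} (hx0 : (x : H →L[ℂ] H).IsPositive)
    (hx1 : ((1 - x : Elem M) : H →L[ℂ] H).IsPositive) {ε : ℝ} (hε : 0 < ε) :
    ∃ h : Elem M, (h : H →L[ℂ] H) ∈ A ∧ (h : H →L[ℂ] H).IsPositive ∧
      ((1 - h : Elem M) : H →L[ℂ] H).IsPositive ∧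
      (τ (x * a)).re ≤ (τ (h * a)).re + ε * (τ 1).re := by
  have hsa : IsSelfAdjoint (a : H →L[ℂ] H) := congrArg Subtype.val ha
  -- `f` approximates the indicator function of `(0, ∞)`.
  let f : ℝ → ℝ := fun s => max 0 (min 1 (s / ε))
  have hf : Continuous f := by fun_prop
  have hf0 : ∀ s, 0 ≤ f s := fun s => le_max_left _ _
  have hf1 : ∀ s, f s ≤ 1 := fun s => max_le zero_le_one (min_le_left _ _)
  let p : Elem M := elemCfc (fun s => max s 0) a
  have hp : (p : H →L[ℂ] H).IsPositive := elemCfc_isPositive fun s => le_max_right _ _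
  have hpa : ((p - a : Elem M) : H →L[ℂ] H).IsPositive := by
    rw [← ContinuousLinearMap.nonneg_iff_isPositive]
    change 0 ≤ cfc (fun s : ℝ => max s 0) (a : H →L[ℂ] H) - a
    nth_rewrite 2 [← cfc_id' ℝ (a : H →L[ℂ] H) hsa]
    rw [← cfc_sub _ _ _ (by fun_prop) (by fun_prop)]
    exact cfc_nonneg fun s _ => sub_nonneg.2 (le_max_left _ _)
  have hq : ((elemCfc f a * a + (ε : ℂ) • 1 - p : Elem M) : H →L[ℂ] H).IsPositive := by
    rw [← ContinuousLinearMap.nonneg_iff_isPositive]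
    have h1 : cfc (fun s : ℝ => f s * s + ε - max s 0) (a : H →L[ℂ] H) =
        cfc f (a : H →L[ℂ] H) * a + (ε : ℂ) • (1 : H →L[ℂ] H)
          - cfc (fun s : ℝ => max s 0) (a : H →L[ℂ] H) := by
      rw [cfc_sub (fun s => f s * s + ε) _ _ (by fun_prop) (by fun_prop),
        cfc_add_const ε (fun s => f s * s) _ (by fun_prop) hsa,
        cfc_mul f (fun s => s) _ (by fun_prop) (by fun_prop), cfc_id' ℝ (a : H →L[ℂ] H) hsa,
        Algebra.algebraMap_eq_smul_one]
      rfl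
    change 0 ≤ cfc f (a : H →L[ℂ] H) * a + (ε : ℂ) • (1 : H →L[ℂ] H)
          - cfc (fun s : ℝ => max s 0) (a : H →L[ℂ] H)
    rw [← h1]
    refine cfc_nonneg fun s _ => ?_
    rcases le_total s 0 with hs | hs
    · have h2 : f s = 0 :=
        max_eq_left ((min_le_right _ _).trans (div_nonpos_of_nonpos_of_nonneg hs hε.le))
      rw [h2, max_eq_right hs]
      linarith
    · rw [max_eq_left hs]
      rcases le_total ε s with h3 | h3
      · have h2 : f s = 1 := by
          simp only [f]
          rw [min_eq_left ((one_le_div hε).2 h3), max_eq_right zero_le_one]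
        rw [h2]
        linarith
      · have := mul_nonneg (hf0 s) hs
        linarith
  refine ⟨elemCfc f a, cfc_mem A _ haA, elemCfc_isPositive hf0, ?_, ?_⟩
  · rw [one_sub_elemCfc ha hf]
    exact elemCfc_isPositive fun s => sub_nonneg.2 (hf1 s)
  · have h1 := (Complex.nonneg_iff.1 (trace_mul_nonneg hτ htr hx0 hpa)).1
    have h2 := (Complex.nonneg_iff.1 (trace_mul_nonneg hτ htr hx1 hp)).1
    have h3 := (Complex.nonneg_iff.1 (hτ _ hq)).1
    simp only [mul_sub, sub_mul, one_mul, map_sub, map_add, map_smul, Complex.sub_re,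
      Complex.add_re, smul_eq_mul, Complex.re_ofReal_mul] at h1 h2 h3
    linarith

/-- A positive contraction `x ∈ M` has the same trace pairing with `A` as some positive contraction
`h ∈ A`. Otherwise Hahn–Banach for the weak topology of the pairing `(x, a) ↦ τ(x a)` yields `a ∈ A`
with `τ(h a)` bounded away from `τ(x a)` for all `h`; that the set of all `h` is weakly closed up to
the kernel of the pairing follows from weak operator compactness of the unit ball. -/
theorem exists_trace_representative {τ : Elem M →ₗ[ℂ] ℂ} (hτ : IsFaithfulNormalTracialState τ)
    {A : VonNeumannAlgebra H} (hA : A ≤ M) {x : Elem M} (hx0 : (x : H →L[ℂ] H).IsPositive)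
    (hx1 : ((1 - x : Elem M) : H →L[ℂ] H).IsPositive) :
    ∃ h : Elem M, (h : H →L[ℂ] H) ∈ A ∧ (h : H →L[ℂ] H).IsPositive ∧
      ∀ a : Elem M, (a : H →L[ℂ] H) ∈ A → τ (h * a) = τ (x * a) := by
  have hpos := hτ.state.positive
  let ι : Elem A →ₗ[ℂ] Elem M := (StarSubalgebra.inclusion
    (show A.toStarSubalgebra ≤ M.toStarSubalgebra from fun _ hx => hA hx)).toAlgHom.toLinearMap
  let B : Elem M →ₗ[ℂ] Elem A →ₗ[ℂ] ℂ := ((LinearMap.mul ℂ (Elem M)).compl₂ ι).compr₂ τ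
  let K : Set (WeakBilin B) := {h : Elem M | (h : H →L[ℂ] H) ∈ A ∧
    (h : H →L[ℂ] H).IsPositive ∧ ((1 - h : Elem M) : H →L[ℂ] H).IsPositive}
  have hKconv : Convex ℝ K := by
    rintro (h : Elem M) ⟨hA1, hp1, hq1⟩ (k : Elem M) ⟨hA2, hp2, hq2⟩ s t hs ht hst
    have h1 := (isPositive_real_smul hs hp1).add (isPositive_real_smul ht hp2)
    have h2 := (isPositive_real_smul hs hq1).add (isPositive_real_smul ht hq2)
    refine ⟨add_mem (A.toStarSubalgebra.smul_mem hA1 (s : ℂ))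
      (A.toStarSubalgebra.smul_mem hA2 (t : ℂ)), h1, ?_⟩
    have h3 : (s : ℂ) • (1 - h : Elem M) + (t : ℂ) • (1 - k : Elem M) =
        1 - ((s : ℂ) • h + (t : ℂ) • k) := by
      rw [smul_sub, smul_sub, sub_add_sub_comm, ← add_smul, ← Complex.ofReal_add, hst,
        Complex.ofReal_one, one_smul]
    have h4 : ((1 - ((s : ℂ) • h + (t : ℂ) • k) : Elem M) :
        H →L[ℂ] H).IsPositive := by
      rw [← h3]
      exact h2
    exact h4
  let x' : WeakBilin B := x
  by_cases hcl : x' ∈ closure K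
  · rw [mem_closure_iff_clusterPt] at hcl
    obtain ⟨(U : Ultrafilter (Elem M)), hUK, hU⟩ := mapClusterPt_iff_ultrafilter.1
      (show MapClusterPt x' (Filter.principal K) id from hcl)
    have hK : ∀ᶠ h : Elem M in (U : Filter (Elem M)), (h : H →L[ℂ] H) ∈ A ∧
      (h : H →L[ℂ] H).IsPositive ∧ ((1 - h : Elem M) : H →L[ℂ] H).IsPositive :=
      Filter.le_principal_iff.1 hUK
    have hnorm : ∀ᶠ h : Elem M in (U : Filter (Elem M)), ‖(h : H →L[ℂ] H)‖ ≤ 1 :=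
      hK.mono fun h hh => norm_le_one_of_isPositive hh.2.1 hh.2.2
    obtain ⟨T, hT⟩ := exists_weak_limit U (fun h : Elem M => (h : H →L[ℂ] H)) hnorm
    have hTA : T ∈ A := mem_of_weak_limit hT (hK.mono fun h hh => hh.1)
    refine ⟨⟨T, hA hTA⟩, hTA, isPositive_of_weak_limit hT (hK.mono fun h hh => hh.2.1),
      fun a ha => ?_⟩
    have h1 : Filter.Tendsto (fun h : Elem M => τ (h * a)) U
        (nhds (τ ((⟨T, hA hTA⟩ : Elem M) * a))) := by
      refine hτ.normal.tendsto (C := ‖(a : H →L[ℂ] H)‖) (fun ξ η => hT ξ ((a : H →L[ℂ] H) η)) ?_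
      filter_upwards [hnorm] with h hh
      refine (norm_mul_le (h : H →L[ℂ] H) (a : H →L[ℂ] H)).trans ?_
      nlinarith [norm_nonneg (a : H →L[ℂ] H)]
    have h2 : Filter.Tendsto (fun h : Elem M => τ (h * a)) U (nhds (τ (x * a))) :=
      ((WeakBilin.eval_continuous B ⟨(a : H →L[ℂ] H), ha⟩).tendsto x').comp hU
    exact tendsto_nhds_unique h1 h2
  · exfalso
    have : ContinuousSMul ℝ (WeakBilin B) := IsScalarTower.continuousSMul ℂ
    obtain ⟨f, u, hf, hu⟩ := RCLike.geometric_hahn_banach_closed_point (𝕜 := ℂ)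
      hKconv.closure isClosed_closure hcl
    obtain ⟨a₀, rfl⟩ := LinearMap.dualEmbedding_surjective B f
    -- Pairing with the self-adjoint part of `a₀` gives the real part.
    let a : Elem M := ((1 / 2 : ℝ) : ℂ) • (ι a₀ + star (ι a₀))
    have hsa : star a = a := by
      simp only [a, star_smul, star_add, star_star, Complex.star_def, Complex.conj_ofReal]
      rw [add_comm]
    have haA : (a : H →L[ℂ] H) ∈ A := by
      have h0 : (a₀ : H →L[ℂ] H) ∈ A.toStarSubalgebra := a₀.2
      exact A.toStarSubalgebra.smul_mem (add_mem h0 (star_mem h0)) _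
    have hre : ∀ y : Elem M, (y : H →L[ℂ] H).IsPositive → (τ (y * ι a₀)).re = (τ (y * a)).re := by
      intro y hy
      have h1 : τ (y * star (ι a₀)) = star (τ (y * ι a₀)) := by
        rw [← hpos.map_star, star_mul, isSelfAdjoint_of_isPositive hy, hτ.tracial]
      simp only [a, mul_smul_comm, mul_add, map_smul, map_add, h1, smul_eq_mul,
        Complex.re_ofReal_mul, Complex.add_re, Complex.star_def, Complex.conj_re]
      ring
    have hu' : u < (τ (x * a)).re := by
      rw [← hre x hx0]
      exact hu
    obtain ⟨h, hhA, hh0, hh1, hle⟩ := exists_trace_mul_le hpos hτ.tracial hsa haA hx0 hx1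
      (sub_pos.2 hu')
    have h3 : (τ (h * ι a₀)).re < u := hf h (subset_closure ⟨hhA, hh0, hh1⟩)
    rw [hre h hh0] at h3
    rw [hτ.state.map_one, Complex.one_re] at hle
    linarith

/-- An element of `A` is determined by its trace pairing with `A`. -/
theorem trace_mul_injective {τ : Elem M →ₗ[ℂ] ℂ} (hτ : IsFaithfulNormalTracialState τ)
    {A : VonNeumannAlgebra H} {h k : Elem M} (hh : (h : H →L[ℂ] H) ∈ A)
    (hk : (k : H →L[ℂ] H) ∈ A)
    (heq : ∀ a : Elem M, (a : H →L[ℂ] H) ∈ A → τ (h * a) = τ (k * a)) : h = k := by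
  rw [← sub_eq_zero]
  refine hτ.faithful _ ?_
  rw [hτ.tracial, sub_mul, map_sub, heq _ (star_mem (sub_mem hh hk)), sub_self]

theorem exists_trace_representative_of_isPositive {τ : Elem M →ₗ[ℂ] ℂ}
    (hτ : IsFaithfulNormalTracialState τ)
    {A : VonNeumannAlgebra H} (hA : A ≤ M) {x : Elem M} (hx : (x : H →L[ℂ] H).IsPositive) :
    ∃ h : Elem M, (h : H →L[ℂ] H) ∈ A ∧ (h : H →L[ℂ] H).IsPositive ∧
      ∀ a : Elem M, (a : H →L[ℂ] H) ∈ A → τ (h * a) = τ (x * a) := by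
  -- Scale `x` to a contraction; adding `1` to the norm avoids a case distinction at `x = 0`.
  set r : ℝ := ‖(x : H →L[ℂ] H)‖ + 1 with hr
  have hr0 : 0 < r := by positivity
  have hrC : (r : ℂ) ≠ 0 := by exact_mod_cast hr0.ne'
  have h1 : ((1 - ((r⁻¹ : ℝ) : ℂ) • x : Elem M) : H →L[ℂ] H).IsPositive := by
    have h2 := (isPositive_norm_sub (isSelfAdjoint_of_isPositive hx)).add
      (ContinuousLinearMap.isPositive_one (𝕜 := ℂ) (E := H))
    have h3 := isPositive_real_smul (M := M) (c := r⁻¹) (by positivity)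
      (x := ((‖(x : H →L[ℂ] H)‖ : ℝ) : ℂ) • 1 - x + 1) h2
    have h4 : ((r⁻¹ : ℝ) : ℂ) • (((‖(x : H →L[ℂ] H)‖ : ℝ) : ℂ) • 1 - x + 1 : Elem M) =
        1 - ((r⁻¹ : ℝ) : ℂ) • x := by
      have h5 : (((‖(x : H →L[ℂ] H)‖ : ℝ) : ℂ) • 1 - x + 1 : Elem M) = (r : ℂ) • 1 - x := by
        rw [hr, Complex.ofReal_add, Complex.ofReal_one, add_smul, one_smul]
        abel
      rw [h5, smul_sub, smul_smul, Complex.ofReal_inv, inv_mul_cancel₀ hrC, one_smul]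
    rwa [h4] at h3
  obtain ⟨h, hhA, hh0, hh⟩ := exists_trace_representative hτ hA
    (isPositive_real_smul (c := r⁻¹) (by positivity) hx) h1
  refine ⟨(r : ℂ) • h, A.toStarSubalgebra.smul_mem hhA _, isPositive_real_smul hr0.le hh0,
    fun a ha => ?_⟩
  rw [smul_mul_assoc, map_smul, hh a ha, smul_mul_assoc, map_smul, smul_smul, Complex.ofReal_inv,
    mul_inv_cancel₀ hrC, one_smul]

theorem exists_isTraceCondExp {τ : Elem M →ₗ[ℂ] ℂ} (hτ : IsFaithfulNormalTracialState τ)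
    {A : VonNeumannAlgebra H} (hA : A ≤ M) : ∃ E, IsTraceCondExp τ A E := by
  let P : Elem M → Prop := fun x => ∃ h : Elem M, (h : H →L[ℂ] H) ∈ A ∧
    ∀ a : Elem M, (a : H →L[ℂ] H) ∈ A → τ (h * a) = τ (x * a)
  have hadd : ∀ {x y}, P x → P y → P (x + y) := by
    rintro x y ⟨h, hhA, hh⟩ ⟨k, hkA, hk⟩
    exact ⟨h + k, add_mem hhA hkA, fun a ha => by
      rw [add_mul, map_add, hh a ha, hk a ha, add_mul, map_add]⟩
  have hsmul : ∀ (c : ℂ) {x}, P x → P (c • x) := by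
    rintro c x ⟨h, hhA, hh⟩
    exact ⟨c • h, A.toStarSubalgebra.smul_mem hhA _, fun a ha => by
      rw [smul_mul_assoc, map_smul, hh a ha, smul_mul_assoc, map_smul]⟩
  have hpos : ∀ {x : Elem M}, (x : H →L[ℂ] H).IsPositive → P x := fun hx =>
    let ⟨h, hhA, _, hh⟩ := exists_trace_representative_of_isPositive hτ hA hx
    ⟨h, hhA, hh⟩
  have hsa : ∀ {x : Elem M}, star x = x → P x := by
    intro x hx
    have h := hadd (hpos (isPositive_norm_add hx)) (hsmul (-((‖(x : H →L[ℂ] H)‖ : ℝ) : ℂ))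
      (hpos (x := 1) ContinuousLinearMap.isPositive_one))
    simpa using h
  have hall : ∀ x, P x := by
    intro x
    have h1 := hsmul (1 / 2) (hsa (x := x + star x) (by rw [star_add, star_star, add_comm]))
    have h2 := hsmul (-Complex.I / 2) (hsa (x := Complex.I • (x - star x)) (by
      rw [star_smul, star_sub, star_star]
      simp only [Complex.star_def, Complex.conj_I, smul_sub, neg_smul]
      abel))
    have h3 := hadd h1 h2
    have h4 : (1 / 2 : ℂ) • (x + star x) + (-Complex.I / 2) • Complex.I • (x - star x) = x := by
      have h5 : -Complex.I / 2 * Complex.I = 1 / 2 := by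
        rw [div_mul_eq_mul_div, neg_mul, Complex.I_mul_I, neg_neg]
      rw [smul_smul, h5, ← smul_add]
      have h6 : x + star x + (x - star x) = (2 : ℂ) • x := by rw [two_smul]; abel
      rw [h6, smul_smul]
      norm_num
    rwa [h4] at h3
  choose F hFA hF using hall
  have huniq : ∀ {x h : Elem M}, (h : H →L[ℂ] H) ∈ A →
      (∀ a : Elem M, (a : H →L[ℂ] H) ∈ A → τ (h * a) = τ (x * a)) → F x = h := by
    intro x h hh heq
    exact trace_mul_injective hτ (hFA x) hh fun a ha => by rw [hF x a ha, heq a ha]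
  let E : Elem M →ₗ[ℂ] Elem M :=
    { toFun := F
      map_add' := fun x y => huniq (add_mem (hFA x) (hFA y)) fun a ha => by
        rw [add_mul, map_add, hF x a ha, hF y a ha, add_mul, map_add]
      map_smul' := fun c x => huniq (A.toStarSubalgebra.smul_mem (hFA x) _) fun a ha => by
        rw [RingHom.id_apply, smul_mul_assoc, map_smul, hF x a ha, smul_mul_assoc, map_smul] }
  refine ⟨E, hFA, fun x hx => huniq hx fun _ _ => rfl, fun x hx => ?_, fun a x b ha hb => ?_,
    fun x => ?_⟩
  · obtain ⟨h, hhA, hh0, hh⟩ := exists_trace_representative_of_isPositive hτ hA hx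
    change (F x : H →L[ℂ] H).IsPositive
    rwa [huniq hhA hh]
  · refine huniq (mul_mem (mul_mem ha (hFA x)) hb) fun c hc => ?_
    change τ (a * F x * b * c) = _
    have h1 : ∀ z : Elem M, τ (a * z * b * c) = τ (z * (b * c * a)) := fun z => by
      rw [mul_assoc, mul_assoc, hτ.tracial, mul_assoc, mul_assoc]
    rw [h1, h1, hF x _ (mul_mem (mul_mem hb hc) ha)]
  · have h := hF x 1 (one_mem A)
    rwa [mul_one, mul_one] at h

theorem isTraceCondExp_condExp {τ : Elem M →ₗ[ℂ] ℂ} (hτ : IsFaithfulNormalTracialState τ)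
    {A : VonNeumannAlgebra H} (hA : A ≤ M) : IsTraceCondExp τ A (condExp τ A) := by
  have h := exists_isTraceCondExp hτ hA
  rw [condExp, dif_pos h]
  exact h.choose_spec

end VNEntropy

theorem corollary2p2p3 {H : Type*} [NormedAddCommGroup H] [InnerProductSpace ℂ H]
    [CompleteSpace H] (M : VonNeumannAlgebra H) (τ : VNEntropy.Elem M →ₗ[ℂ] ℂ)
    (hτ : VNEntropy.IsFaithfulNormalTracialState τ)
    (A B : VonNeumannAlgebra H) (hA : A ≤ M) (hB : B ≤ M)
    (hcomm : VNEntropy.condExp τ A ∘ₗ VNEntropy.condExp τ B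
      = VNEntropy.condExp τ B ∘ₗ VNEntropy.condExp τ A) :
    VNEntropy.csEntropy τ A B = VNEntropy.condEntropy τ A B ∧
      ∀ φ : VNEntropy.Elem M →ₗ[ℂ] ℂ, VNEntropy.IsState φ → VNEntropy.IsNormalFunctional φ →
        φ = φ ∘ₗ VNEntropy.condExp τ A →
        VNEntropy.csEntropyState hA hB φ = VNEntropy.condEntropyState τ hA hB φ := by
  have hEA := VNEntropy.isTraceCondExp_condExp hτ hA
  have hEB := VNEntropy.isTraceCondExp_condExp hτ hB
  have hc : ∀ x, VNEntropy.condExp τ A (VNEntropy.condExp τ B x) =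
      VNEntropy.condExp τ B (VNEntropy.condExp τ A x) := fun x => LinearMap.congr_fun hcomm x
  refine ⟨VNEntropy.csEntropy_eq_condEntropy hτ.state.positive hτ.normal hEA hEB hc,
    fun φ hφ _ hφA => VNEntropy.csEntropyState_eq_condEntropyState hA hB hEA (fun b hb => ?_)
      hφ.positive hφA⟩
  rw [← hEB.map_of_mem b hb, hc]
  exact hEB.mem _
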